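/- **Moments of the Laguerre unitary ensemble for complex order.** Let $n\ge 1$ be an integer. For real $b>-1$ the Laguerre unitary ensemble has eigenvalue density $$p(x_1,\dots,x_n)=\frac1C\prod_{j=1}^n x_j^{b}e^{-x_j}\prod_{1\le i<j\le n}|x_j-x_i|^2,\qquad x_j\ge 0,$$ where $C>0$ is the (finite) normalization constant, and for complex $k$ with $b+\operatorname{Re}k>-1$ its $k$-th moment is the absolutely convergent integral $$M^{(2)}_{\mathrm L_b}(k,n)=\int_{[0,\infty)^n}\bigl(x_1^k+\dots+x_n^k\bigr)\,p(x_1,\dots,x_n)\,dx_1\cdots dx_n .$$ Write $(z)_{(s)}=\Gamma(z+s)/\Gamma(z)$ and $\binom{k}{j}=\frac{\Gamma(k+1)}{\Gamma(k-j+1)\Gamma(j+1)}$ (with $1/\Gamma=0$ at the poles of $\Gamma$); for negative integer upper index the binomial is given by the limiting form $\binom{-k}{j}=(-1)^j\binom{k+j-1}{k-1}$ for $j\ge0$ and is $0$ for $j<0$. Then: 1. The function $(b,k)\mapsto M^{(2)}_{\mathrm L_b}(k,n)$ has a unique analytic continuation to the set of all $(b,k)\in\mathbb C^2$ such that neither $b+n$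 nor $b+k$ is a negative integer. Denote it by the same symbol. 2. For all complex $b,k$ such that neither $b+n$ nor $b+k$ is a negative integer, and $k\ne0$, $$M^{(2)}_{\mathrm L_b}(k,n)=\frac1k\sum_{j=0}^{n}\binom kj\binom k{j-1}\frac{(b+n)_{(k-j+1)}}{(n+1)_{(-j)}}.$$ In particular this holds for the integral itself when $b>-1$ is real and $b+\operatorname{Re}k>-1$, $k\neq 0$. 3. If moreover $k$ is a positive integer, then at most $k$ terms of this sum are nonzero, and $$M^{(2)}_{\mathrm L_b}(k,n)=\frac1k\sum_{j=0}^{\min(n,k)}\binom kj\binom k{j-1}\frac{(b+n)_{(k-j+1)}}{(n+1)_{(-j)}}.$$ 4. If $k$ is a positive integer and neither $b+n$ nor $b-k$ is a negative integer, then $$M^{(2)}_{\mathrm L_b}(-k,n)=\frac1k\sum_{j=0}^{n-1}\binom{k+j}{k-1}\binom{k+j-1}{k-1}\frac{(b+n)_{(-k-j)}}{(n+1)_{(-j-1)}}.$$ -/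

import Mathlib

open MeasureTheory

/-- The generalized Pochhammer symbol `(z)_{(s)} = Γ(z + s) / Γ(z)`.  Since `Complex.Gamma` takes the
value `0` at its poles, the right-hand side is `0` when only `Γ(z)` is at a pole, as it should be. -/
noncomputable def pochhammerSymbol (z s : ℂ) : ℂ :=
  Complex.Gamma (z + s) / Complex.Gamma z

/-- `z` is a negative integer. -/
def IsNegInt (z : ℂ) : Prop := ∃ m : ℕ, z = -((m : ℂ) + 1)

open Classical in
/-- The binomial coefficient with complex upper index `k` and integer lower index `j`, that is
`Γ(k + 1) / (Γ(k - j + 1) Γ(j + 1))`, where `1 / Γ` vanishes at the poles of `Γ`; at the negative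
integers `k = -p` it is given by the limiting form
`(-1) ^ j * Γ(p + j) / (Γ(p) Γ(j + 1)) = (-1) ^ j * choose (p + j - 1) (p - 1)`
(which is `0` for `j < 0`). -/
noncomputable def genBinom (k : ℂ) (j : ℤ) : ℂ :=
  if IsNegInt k then
    (-1) ^ j * (Complex.Gamma (-k + j) / (Complex.Gamma (-k) * Complex.Gamma (j + 1)))
  else
    Complex.Gamma (k + 1) / (Complex.Gamma (k - j + 1) * Complex.Gamma (j + 1))

/-- The unnormalized joint density of the eigenvalues of the Laguerre unitary ensemble,
`∏ j, x_j ^ b e^{-x_j} ∏_{i < j} |x_j - x_i| ^ 2`. -/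
noncomputable def lueDensity (n : ℕ) (b : ℝ) (x : Fin n → ℝ) : ℝ :=
  (∏ j, x j ^ b * Real.exp (-x j)) * ∏ i, ∏ j ∈ Finset.Ioi i, |x j - x i| ^ 2

/-- The domain of integration `[0, ∞)^n`. -/
def lueDomain (n : ℕ) : Set (Fin n → ℝ) := {x | ∀ j, 0 ≤ x j}

/-- The normalization constant `C`. -/
noncomputable def lueNorm (n : ℕ) (b : ℝ) : ℝ :=
  ∫ x in lueDomain n, lueDensity n b x

/-- The unnormalized integrand `(∑ j, x_j ^ k) ∏ j, x_j ^ b e^{-x_j} ∏_{i < j} |x_j - x_i| ^ 2`. -/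
noncomputable def lueIntegrand (n : ℕ) (b : ℝ) (k : ℂ) (x : Fin n → ℝ) : ℂ :=
  (∑ j, (x j : ℂ) ^ k) * (lueDensity n b x : ℂ)

/-- The `k`-th moment of the eigenvalues of the Laguerre unitary ensemble, as an average. -/
noncomputable def lueAverage (n : ℕ) (b : ℝ) (k : ℂ) : ℂ :=
  1 / (lueNorm n b : ℂ) * ∫ x in lueDomain n, lueIntegrand n b k x

/-- The pairs `(b, k)` of complex numbers such that neither `b + n` nor `b + k` is a negative
integer. -/
def lueParams (n : ℕ) : Set (ℂ × ℂ) :=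
  {p | ¬ IsNegInt (p.1 + n) ∧ ¬ IsNegInt (p.1 + p.2)}

/-- `M` is an analytic continuation of the moments of the Laguerre unitary ensemble, from the
pairs `(b, k)`, `b > -1` real and `k` complex with `b + Re k > -1`, for which the ensemble is defined
and the integral converges, to all pairs in `lueParams n`. -/
structure IsLUEMoment (n : ℕ) (M : ℂ → ℂ → ℂ) : Prop where
  analytic : AnalyticOnNhd ℂ (fun p : ℂ × ℂ => M p.1 p.2) (lueParams n)
  eq_average : ∀ (b : ℝ) (k : ℂ), -1 < b → -1 < b + k.re → M b k = lueAverage n b k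

/-- The summand `C(k, j) C(k, j - 1) (b + n)_{(k - j + 1)} / (n + 1)_{(-j)}`. -/
noncomputable def lueTerm (n : ℕ) (b k : ℂ) (j : ℕ) : ℂ :=
  genBinom k j * genBinom k ((j : ℤ) - 1) *
    (pochhammerSymbol (b + n) (k - j + 1) / pochhammerSymbol ((n : ℂ) + 1) (-(j : ℂ)))

/-! ### Binomial coefficients and Gamma quotients -/

open Polynomial

/-! The density is a product of weights times a squared Vandermonde determinant, whose rows may be
replaced by the monic Laguerre polynomials π_i of parameter b. Multiplying by x_l ^ k only changes
the exponent of one weight from b to b + k. Andréief's identity therefore reduces the moment to a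
sum over i < n of ∫ π_i² x^(b+k) e^(-x) divided by ∫ π_i² x^b e^(-x) (`integral_prod_mul_det_sq`,
`integral_lueIntegrand`).

By Chu–Vandermonde, π_i expands in the Laguerre polynomials of parameter b + k with coefficients (i!
/ m!) C(k, i - m) (`monicLaguerre_eq_sum`). Orthogonality for the weight of parameter b + k then
turns each numerator into a single sum of squared binomials. The resulting double sum equals the
closed form `lueMoment` because the increment of `lueMoment` from n to n + 1 is exactly the term i =
n; this rests on Pascal's rule (`sum_lueCoeff_sub_sum_lueCoeff`).

The closed form involves 1 / Γ(b + n), which is entire, and Γ(b + k + n - r) with r < n, which has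
poles only where b + k is a negative integer. It is thus the continuation, and the identity theorem
in b for fixed k makes it unique (`IsLUEMoment.eq`). -/

theorem succ_mul_ringChoose_succ (k : ℂ) (r : ℕ) :
    ((r : ℂ) + 1) * Ring.choose k (r + 1) = (k - r) * Ring.choose k r := by
  have h1 := Ring.descPochhammer_eq_factorial_smul_choose k r
  have h2 := Ring.descPochhammer_eq_factorial_smul_choose k (r + 1)
  rw [descPochhammer_succ_right, smeval_mul, h1] at h2
  simp [smeval_sub, smeval_natCast, Nat.factorial_succ] at h2
  have : (r.factorial : ℂ) ≠ 0 := by exact_mod_cast r.factorial_ne_zero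
  apply mul_left_cancel₀ this
  linear_combination -h2

theorem Gamma_add_nat_eq_mul_ringChoose {z : ℂ} (hz : 0 < z.re) (N : ℕ) :
    Complex.Gamma (z + N) =
      Complex.Gamma z * ((-1) ^ N * (N.factorial : ℂ) * Ring.choose (-z) N) := by
  induction N with
  | zero => simp
  | succ N ih =>
    have h0 : z + N ≠ 0 := by
      intro h
      have := congrArg Complex.re h
      simp at this
      have : (0 : ℝ) ≤ N := N.cast_nonneg
      linarith
    have h := succ_mul_ringChoose_succ (-z) N
    rw [Nat.cast_succ, ← add_assoc, Complex.Gamma_add_one _ h0, ih, Nat.factorial_succ]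
    push_cast
    linear_combination (-Complex.Gamma z * (-1) ^ N * (-1) * N.factorial) * h

/-! ### Laguerre polynomials: orthogonality and change of parameter -/

/-- The linear functional `X ^ m ↦ Γ(a + m + 1)`, that is integration against `x ^ a e^{-x}`. -/
noncomputable def gammaFunctional (a : ℂ) : ℂ[X] →ₗ[ℂ] ℂ :=
  (Polynomial.basisMonomials ℂ).constr ℂ fun m => Complex.Gamma (a + m + 1)

theorem gammaFunctional_X_pow (a : ℂ) (m : ℕ) :
    gammaFunctional a (X ^ m) = Complex.Gamma (a + m + 1) := by
  have := (Polynomial.basisMonomials ℂ).constr_basis ℂ (fun m => Complex.Gamma (a + m + 1)) m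
  simpa only [gammaFunctional, Polynomial.coe_basisMonomials, ← X_pow_eq_monomial] using this

theorem gammaFunctional_C_mul (a c : ℂ) (p : ℂ[X]) :
    gammaFunctional a (C c * p) = c * gammaFunctional a p := by
  rw [← smul_eq_C_mul, map_smul, smul_eq_mul]

/-- The monic Laguerre polynomial of degree `i` and parameter `a`. -/
noncomputable def monicLaguerre (a : ℂ) (i : ℕ) : ℂ[X] :=
  ∑ l ∈ Finset.range (i + 1),
    C ((i.factorial : ℂ) / l.factorial * Ring.choose (-(a + l + 1)) (i - l)) * X ^ l

theorem monicLaguerre_coeff (a : ℂ) (i l : ℕ) :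
    (monicLaguerre a i).coeff l = if l ≤ i then
      (i.factorial : ℂ) / l.factorial * Ring.choose (-(a + l + 1)) (i - l) else 0 := by
  simp only [monicLaguerre, finsetSum_coeff, coeff_C_mul, coeff_X_pow, mul_ite, mul_one, mul_zero,
    Finset.sum_ite_eq, Finset.mem_range, Nat.lt_succ_iff]

theorem monicLaguerre_natDegree_le (a : ℂ) (i : ℕ) : (monicLaguerre a i).natDegree ≤ i := by
  rw [natDegree_le_iff_coeff_eq_zero]
  intro l hl
  rw [monicLaguerre_coeff, if_neg (by omega)]

theorem monicLaguerre_coeff_self (a : ℂ) (i : ℕ) : (monicLaguerre a i).coeff i = 1 := by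
  have : (i.factorial : ℂ) ≠ 0 := by exact_mod_cast i.factorial_ne_zero
  simp [monicLaguerre_coeff, this]

theorem monicLaguerre_monic (a : ℂ) (i : ℕ) : (monicLaguerre a i).Monic :=
  monic_of_natDegree_le_of_coeff_eq_one i (monicLaguerre_natDegree_le a i)
    (monicLaguerre_coeff_self a i)

theorem monicLaguerre_natDegree (a : ℂ) (i : ℕ) : (monicLaguerre a i).natDegree = i :=
  natDegree_eq_of_le_of_coeff_ne_zero (monicLaguerre_natDegree_le a i)
    (by simp [monicLaguerre_coeff_self])

/-- Factor Γ(a + l + m + 1) as Γ(a + l + 1) times a rising factorial of length m. The coefficient of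
`X ^ l` completes Γ(a + l + 1) to Γ(a + i + 1), leaving the alternating binomial weights of an i-th
difference. -/
theorem gammaFunctional_X_pow_mul_monicLaguerre {a : ℂ} (ha : -1 < a.re) (m i : ℕ) :
    gammaFunctional a (X ^ m * monicLaguerre a i) =
      Complex.Gamma (a + i + 1) *
        (fwdDiff (1 : ℂ))^[i] (fun z => (ascPochhammer ℂ m).eval z) (a + 1) := by
  rw [fwdDiff_iter_eq_sum_shift, monicLaguerre, Finset.mul_sum, map_sum, Finset.mul_sum]
  refine Finset.sum_congr rfl fun l hl => ?_
  have hl' : l ≤ i := by simpa [Nat.lt_succ_iff] using hl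
  have hre : 0 < (a + l + 1).re := by
    have : (0 : ℝ) ≤ l := l.cast_nonneg
    simp; linarith
  have hpole : ∀ k : ℕ, a + l + 1 ≠ -(k : ℂ) := by
    intro k h
    rw [h] at hre
    have : (0 : ℝ) ≤ k := k.cast_nonneg
    simp at hre; linarith
  have hG : Complex.Gamma (a + l + 1) ≠ 0 := Complex.Gamma_ne_zero_of_re_pos hre
  have h1 := Gamma_add_nat_eq_mul_ringChoose hre (i - l)
  have h2 := Complex.Gamma_add_nat_div_Gamma_eq (n := m) _ hpole
  rw [div_eq_iff hG] at h2
  have e1 : a + l + 1 + ((i - l : ℕ) : ℂ) = a + i + 1 := by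
    rw [Nat.cast_sub hl']; ring
  rw [e1] at h1
  have e2 : X ^ m * (C ((i.factorial : ℂ) / l.factorial * Ring.choose (-(a + l + 1)) (i - l)) * X ^ l)
      = C ((i.factorial : ℂ) / l.factorial * Ring.choose (-(a + l + 1)) (i - l)) * X ^ (l + m) := by
    ring
  rw [e2, gammaFunctional_C_mul, gammaFunctional_X_pow]
  have e3 : a + ((l + m : ℕ) : ℂ) + 1 = a + l + 1 + m := by push_cast; ring
  have e4 : a + 1 + l • (1 : ℂ) = a + l + 1 := by simp; ring
  rw [e3, e4, h2, h1]
  have hf : (i.choose l : ℂ) * l.factorial * (i - l).factorial = i.factorial := by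
    exact_mod_cast Nat.choose_mul_factorial_mul_factorial hl'
  have hl0 : (l.factorial : ℂ) ≠ 0 := by exact_mod_cast l.factorial_ne_zero
  have hs : ((-1 : ℂ) ^ (i - l)) * (-1) ^ (i - l) = 1 := by rw [← mul_pow]; simp
  simp only [zsmul_eq_mul]
  push_cast
  rw [← hf]
  field_simp
  linear_combination (-((i.choose l : ℂ) * (i - l).factorial *
    Ring.choose (-(a + l + 1)) (i - l) * (ascPochhammer ℂ m).eval (a + l + 1))) * hs

/-- The rising factorial of length m is a monic polynomial of degree m, so its i-th difference is 0
for m < i and i! for m = i: only the top coefficient of q is seen. -/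
theorem gammaFunctional_mul_monicLaguerre {a : ℂ} (ha : -1 < a.re) {q : ℂ[X]} {i : ℕ}
    (hq : q.natDegree ≤ i) :
    gammaFunctional a (q * monicLaguerre a i) =
      q.coeff i * (i.factorial * Complex.Gamma (a + i + 1)) := by
  conv_lhs => rw [q.as_sum_range_C_mul_X_pow' (Nat.lt_succ_of_le hq)]
  rw [Finset.sum_mul, map_sum, Finset.sum_range_succ, Finset.sum_eq_zero, zero_add]
  · rw [mul_assoc, gammaFunctional_C_mul, gammaFunctional_X_pow_mul_monicLaguerre ha]
    have := (ascPochhammer ℂ i).fwdDiff_iter_degree_eq_factorial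
    rw [ascPochhammer_natDegree, (monic_ascPochhammer ℂ i).leadingCoeff] at this
    rw [this, Pi.smul_apply, Pi.natCast_apply, one_smul]
    ring
  · intro m hm
    rw [mul_assoc, gammaFunctional_C_mul, gammaFunctional_X_pow_mul_monicLaguerre ha,
      Polynomial.fwdDiff_iter_eq_zero_of_degree_lt]
    · simp
    · rw [ascPochhammer_natDegree]; simpa using hm

theorem gammaFunctional_monicLaguerre_mul_monicLaguerre {a : ℂ} (ha : -1 < a.re) (i m : ℕ) :
    gammaFunctional a (monicLaguerre a i * monicLaguerre a m) =
      if i = m then i.factorial * Complex.Gamma (a + i + 1) else 0 := by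
  wlog h : i ≤ m generalizing i m
  · rw [mul_comm, this m i (by omega)]
    simp only [eq_comm (a := m)]
    split_ifs with h' <;> simp [h']
  rw [gammaFunctional_mul_monicLaguerre ha ((monicLaguerre_natDegree_le a i).trans h)]
  split_ifs with h'
  · subst h'; rw [monicLaguerre_coeff_self, one_mul]
  · rw [monicLaguerre_coeff, if_neg (by omega), zero_mul]

/-- Comparing coefficients of `X ^ l`, this is Chu–Vandermonde for the splitting -(b + l + 1) = k +
(-(b + k + l + 1)). -/
theorem monicLaguerre_eq_sum (b k : ℂ) (i : ℕ) :
    monicLaguerre b i = ∑ m ∈ Finset.range (i + 1),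
      C ((i.factorial : ℂ) / m.factorial * Ring.choose k (i - m)) * monicLaguerre (b + k) m := by
  ext l
  simp only [finsetSum_coeff, coeff_C_mul, monicLaguerre_coeff]
  split_ifs with hl
  · have hv := Ring.add_choose_eq (i - l) (Commute.all k (-(b + k + l + 1)))
    rw [show k + -(b + k + l + 1) = -(b + l + 1) by ring] at hv
    rw [hv, Finset.Nat.sum_antidiagonal_eq_sum_range_succ_mk, Finset.mul_sum]
    -- Indices m < l contribute nothing, since the polynomial of index m has degree m; the others
    -- match Vandermonde's sum under m ↦ i - m.
    rw [← Finset.sum_filter_add_sum_filter_not (Finset.range (i + 1)) (fun m => l ≤ m)]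
    rw [Finset.sum_eq_zero (s := Finset.filter (fun m => ¬ l ≤ m) _), add_zero]
    · symm
      refine Finset.sum_bij' (fun m _ => i - m) (fun r _ => i - r) ?_ ?_ ?_ ?_ ?_
      · intro m hm; simp at hm ⊢; omega
      · intro m hm; simp at hm ⊢; omega
      · intro m hm; simp at hm ⊢; omega
      · intro m hm; simp at hm ⊢; omega
      · intro m hm
        simp at hm
        have : i - l - (i - m) = m - l := by omega
        have hm0 : (m.factorial : ℂ) ≠ 0 := by exact_mod_cast m.factorial_ne_zero
        rw [if_pos hm.2, this]
        field_simp
    · intro m hm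
      simp at hm
      rw [if_neg (by omega), mul_zero]
  · rw [Finset.sum_eq_zero]
    intro m hm
    simp at hm
    rw [if_neg (by omega), mul_zero]

theorem gammaFunctional_add_monicLaguerre_sq {b k : ℂ} (h : -1 < (b + k).re) (i : ℕ) :
    gammaFunctional (b + k) (monicLaguerre b i * monicLaguerre b i) =
      ∑ m ∈ Finset.range (i + 1), ((i.factorial : ℂ) * Ring.choose k (i - m)) ^ 2 *
        (Complex.Gamma (b + k + m + 1) / m.factorial) := by
  conv_lhs => rw [monicLaguerre_eq_sum b k i]
  rw [Finset.sum_mul, map_sum]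
  refine Finset.sum_congr rfl fun m hm => ?_
  have hm0 : (m.factorial : ℂ) ≠ 0 := by exact_mod_cast m.factorial_ne_zero
  rw [Finset.mul_sum, map_sum, Finset.sum_eq_single m]
  · rw [mul_mul_mul_comm, ← C_mul, gammaFunctional_C_mul,
      gammaFunctional_monicLaguerre_mul_monicLaguerre h, if_pos rfl]
    field_simp
  · intro m' _ hne
    rw [mul_mul_mul_comm, ← C_mul, gammaFunctional_C_mul,
      gammaFunctional_monicLaguerre_mul_monicLaguerre h, if_neg hne.symm, mul_zero]
  · exact fun h' => absurd hm h'

/-! ### The closed form, by telescoping in n -/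

theorem ringChoose_succ (k : ℂ) (r : ℕ) :
    Ring.choose k (r + 1) = Ring.choose (k - 1) r + Ring.choose (k - 1) (r + 1) := by
  simpa using Ring.choose_succ_succ (k - 1) r

theorem succ_mul_ringChoose_succ_eq_mul (k : ℂ) (r : ℕ) :
    ((r : ℂ) + 1) * Ring.choose k (r + 1) = k * Ring.choose (k - 1) r := by
  rw [ringChoose_succ, mul_add, succ_mul_ringChoose_succ]
  ring

/-- The coefficient `C(k, r + 1) C(k, r) / k`, with the division carried out. -/
noncomputable def lueCoeff (k : ℂ) (r : ℕ) : ℂ :=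
  Ring.choose (k - 1) r * Ring.choose k r / (r + 1)

theorem succ_mul_lueCoeff (k : ℂ) (r : ℕ) :
    ((r : ℂ) + 1) * lueCoeff k r = Ring.choose (k - 1) r * Ring.choose k r := by
  have : (r : ℂ) + 1 ≠ 0 := Nat.cast_add_one_ne_zero r
  rw [lueCoeff]; field_simp

theorem sub_mul_lueCoeff (k : ℂ) (r : ℕ) :
    (k - r) * lueCoeff k r = Ring.choose (k - 1) r * Ring.choose k (r + 1) := by
  have : (r : ℂ) + 1 ≠ 0 := Nat.cast_add_one_ne_zero r
  have h := succ_mul_ringChoose_succ k r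
  rw [lueCoeff]; field_simp
  linear_combination (-Ring.choose (k - 1) r) * h

theorem mul_lueCoeff (k : ℂ) (r : ℕ) :
    k * lueCoeff k r = Ring.choose k (r + 1) * Ring.choose k r := by
  have : (r : ℂ) + 1 ≠ 0 := Nat.cast_add_one_ne_zero r
  have h := succ_mul_ringChoose_succ_eq_mul k r
  rw [lueCoeff]; field_simp
  linear_combination (-Ring.choose k r) * h

/-- Split n + 1 = (r + 1) + (n - r) and use `hG` to move the second part onto `G (r + 1)`.
Subtracting b + n leaves the factor k - r there, so `G (r + 1)` carries C(k, r + 1) (C(k - 1, r + 1)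
+ C(k - 1, r)), a square by Pascal's rule. -/
theorem sum_lueCoeff_sub_sum_lueCoeff (b k : ℂ) (n : ℕ) (G : ℕ → ℂ)
    (hG : ∀ r < n, ((n : ℂ) - r) * G r = (b + k + n - r) * G (r + 1)) :
    (n + 1) * ∑ r ∈ Finset.range (n + 1), lueCoeff k r * G r
        - (b + n) * ∑ r ∈ Finset.range n, lueCoeff k r * G (r + 1) =
      ∑ r ∈ Finset.range (n + 1), Ring.choose k r ^ 2 * G r := by
  have h1 : (n + 1) * ∑ r ∈ Finset.range (n + 1), lueCoeff k r * G r =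
      ∑ r ∈ Finset.range (n + 1), (r + 1) * lueCoeff k r * G r +
        ∑ r ∈ Finset.range n, (b + k + n - r) * lueCoeff k r * G (r + 1) := by
    have : ∑ r ∈ Finset.range n, (b + k + n - r) * lueCoeff k r * G (r + 1) =
        ∑ r ∈ Finset.range (n + 1), ((n : ℂ) - r) * lueCoeff k r * G r := by
      rw [Finset.sum_range_succ, sub_self, zero_mul, zero_mul, add_zero]
      refine Finset.sum_congr rfl fun r hr => ?_
      linear_combination (-lueCoeff k r) * hG r (Finset.mem_range.1 hr)
    rw [this, ← Finset.sum_add_distrib, Finset.mul_sum]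
    exact Finset.sum_congr rfl fun r _ => by ring
  rw [h1, add_sub_assoc, Finset.mul_sum, ← Finset.sum_sub_distrib, Finset.sum_range_succ',
    Finset.sum_range_succ' (fun r => Ring.choose k r ^ 2 * G r), add_right_comm,
    ← Finset.sum_add_distrib]
  congr 1
  · refine Finset.sum_congr rfl fun r _ => ?_
    rw [succ_mul_lueCoeff]
    have h2 := sub_mul_lueCoeff k r
    have h3 := ringChoose_succ k r
    linear_combination G (r + 1) * h2 - Ring.choose k (r + 1) * G (r + 1) * h3
  · rw [succ_mul_lueCoeff]; simp

/-- The closed form of the `k`-th moment of the Laguerre unitary ensemble. -/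
noncomputable def lueMoment (n : ℕ) (b k : ℂ) : ℂ :=
  ∑ r ∈ Finset.range n, lueCoeff k r * ((n.factorial : ℂ) / (n - 1 - r).factorial) *
    (Complex.Gamma (b + k + n - r) * (Complex.Gamma (b + n))⁻¹)

theorem sum_ringChoose_sq_eq_lueMoment {b k : ℂ} (hb : -1 < b.re) (hk : -1 < (b + k).re) (n : ℕ) :
    ∑ i ∈ Finset.range n, (i.factorial : ℂ) / Complex.Gamma (b + i + 1) *
      ∑ m ∈ Finset.range (i + 1), Ring.choose k (i - m) ^ 2 *
        (Complex.Gamma (b + k + m + 1) / m.factorial) = lueMoment n b k := by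
  induction n with
  | zero => simp [lueMoment]
  | succ n ih =>
    rw [Finset.sum_range_succ, ih]
    set G : ℕ → ℂ := fun r => Complex.Gamma (b + k + n - r + 1) / (n - r).factorial with hGdef
    have hG : ∀ r < n, ((n : ℂ) - r) * G r = (b + k + n - r) * G (r + 1) := by
      intro r hr
      have hne : b + k + n - r ≠ 0 := by
        intro h
        have h' := congrArg Complex.re h
        have : (r : ℝ) + 1 ≤ n := by exact_mod_cast hr
        simp at h' hk
        linarith
      obtain ⟨d, rfl⟩ := Nat.exists_eq_add_of_lt hr
      simp only [hGdef]
      rw [Complex.Gamma_add_one _ hne, show r + d + 1 - r = d + 1 by omega,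
        show r + d + 1 - (r + 1) = d by omega, Nat.factorial_succ]
      have hd : (d.factorial : ℂ) ≠ 0 := by exact_mod_cast d.factorial_ne_zero
      have hd' : (d : ℂ) + 1 ≠ 0 := Nat.cast_add_one_ne_zero d
      rw [show b + k + ((r + d + 1 : ℕ) : ℂ) - ((r + 1 : ℕ) : ℂ) + 1
        = b + k + ((r + d + 1 : ℕ) : ℂ) - r by push_cast; ring]
      push_cast
      field_simp
      ring
    have key := sum_lueCoeff_sub_sum_lueCoeff b k n G hG
    have e1 : ∑ m ∈ Finset.range (n + 1), Ring.choose k (n - m) ^ 2 *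
        (Complex.Gamma (b + k + m + 1) / m.factorial) =
        ∑ r ∈ Finset.range (n + 1), Ring.choose k r ^ 2 * G r := by
      rw [← Finset.sum_range_reflect]
      refine Finset.sum_congr rfl fun r hr => ?_
      have hr' : r ≤ n := by simpa [Nat.lt_succ_iff] using hr
      rw [show n + 1 - 1 - r = n - r by omega, show n - (n - r) = r by omega, Nat.cast_sub hr']
      simp only [hGdef]
      congr 3
      ring
    have e2 : lueMoment (n + 1) b k = n.factorial / Complex.Gamma (b + n + 1) *
        ((n + 1) * ∑ r ∈ Finset.range (n + 1), lueCoeff k r * G r) := by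
      rw [lueMoment, Finset.mul_sum, Finset.mul_sum]
      refine Finset.sum_congr rfl fun r _ => ?_
      simp only [hGdef, Nat.factorial_succ, show n + 1 - 1 - r = n - r by omega]
      push_cast
      rw [show b + k + (n + 1 : ℂ) - r = b + k + n - r + 1 by ring,
        show b + (n + 1 : ℂ) = b + n + 1 by ring]
      ring
    have e3 : lueMoment n b k = n.factorial / Complex.Gamma (b + n + 1) *
        ((b + n) * ∑ r ∈ Finset.range n, lueCoeff k r * G (r + 1)) := by
      -- For n = 0 the sum is empty, while b itself may be 0 and the functional equation of Γ
      -- unavailable; for n ≥ 1 the real part of b + n is positive.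
      rcases Nat.eq_zero_or_pos n with rfl | hn
      · simp [lueMoment]
      have hn' : (1 : ℝ) ≤ n := by exact_mod_cast hn
      have hne : b + n ≠ 0 := by
        intro h
        have h' := congrArg Complex.re h
        simp at h'
        linarith
      rw [Complex.Gamma_add_one _ hne, lueMoment, Finset.mul_sum, Finset.mul_sum]
      refine Finset.sum_congr rfl fun r _ => ?_
      simp only [hGdef, show n - 1 - r = n - (r + 1) by omega]
      rw [show b + k + n - ((r + 1 : ℕ) : ℂ) + 1 = b + k + n - r by push_cast; ring]
      field_simp
    rw [e1, ← key, e2, e3]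
    ring

/-! ### Andréief's identity -/

open Matrix in
theorem prod_mul_det_sq {ι R : Type*} [Fintype ι] [DecidableEq ι] [CommRing R]
    (w : ι → R) (A : Matrix ι ι R) :
    (∏ j, w j) * A.det ^ 2 = ∑ σ : Equiv.Perm ι, ∑ τ : Equiv.Perm ι,
      ((Equiv.Perm.sign σ : ℤ) : R) * ((Equiv.Perm.sign τ : ℤ) : R) *
        ∏ j, w j * (A (σ j) j * A (τ j) j) := by
  rw [sq, det_apply', Finset.sum_mul_sum, Finset.mul_sum]
  refine Finset.sum_congr rfl fun σ _ => ?_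
  rw [Finset.mul_sum]
  refine Finset.sum_congr rfl fun τ _ => ?_
  rw [Finset.prod_mul_distrib, Finset.prod_mul_distrib]
  ring

section Andreief

variable {ι X : Type*} [Fintype ι] [DecidableEq ι] [MeasurableSpace X] {μ : Measure X}
  [SigmaFinite μ] {w g : ι → X → ℂ}

theorem integrable_prod_mul_det_sq
    (hint : ∀ j p q, Integrable (fun x => w j x * (g p x * g q x)) μ) :
    Integrable (fun x : ι → X => (∏ j, w j (x j)) * (Matrix.of fun i j => g i (x j)).det ^ 2)
      (Measure.pi fun _ => μ) := by
  simp only [prod_mul_det_sq, Matrix.of_apply]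
  refine integrable_finsetSum _ fun σ _ => integrable_finsetSum _ fun τ _ => ?_
  exact (Integrable.fintype_prod (f := fun j x => w j x * (g (σ j) x * g (τ j) x))
    fun j => hint j _ _).const_mul _

/-- Andréief's identity for an orthogonal family, where the weight of one variable `l` may be
arbitrary. -/
theorem integral_prod_mul_det_sq
    (hint : ∀ j p q, Integrable (fun x => w j x * (g p x * g q x)) μ) (l : ι)
    (horth : ∀ j p q, j ≠ l → p ≠ q → ∫ x, w j x * (g p x * g q x) ∂μ = 0) :
    ∫ x : ι → X, (∏ j, w j (x j)) * (Matrix.of fun i j => g i (x j)).det ^ 2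
      ∂(Measure.pi fun _ => μ) =
      ∑ σ : Equiv.Perm ι, ∏ j, ∫ x, w j x * (g (σ j) x * g (σ j) x) ∂μ := by
  have hi : ∀ σ τ : Equiv.Perm ι, Integrable (fun x : ι → X =>
      ((Equiv.Perm.sign σ : ℤ) : ℂ) * ((Equiv.Perm.sign τ : ℤ) : ℂ) *
        ∏ j, w j (x j) * (g (σ j) (x j) * g (τ j) (x j))) (Measure.pi fun _ => μ) := fun σ τ =>
    (Integrable.fintype_prod (f := fun j x => w j x * (g (σ j) x * g (τ j) x))
      fun j => hint j _ _).const_mul _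
  simp only [prod_mul_det_sq, Matrix.of_apply]
  rw [integral_finsetSum _ fun σ _ => integrable_finsetSum _ fun τ _ => hi σ τ]
  refine Finset.sum_congr rfl fun σ _ => ?_
  rw [integral_finsetSum _ fun τ _ => hi σ τ]
  have hval : ∀ τ : Equiv.Perm ι, ∫ x : ι → X,
      ((Equiv.Perm.sign σ : ℤ) : ℂ) * ((Equiv.Perm.sign τ : ℤ) : ℂ) *
        ∏ j, w j (x j) * (g (σ j) (x j) * g (τ j) (x j)) ∂(Measure.pi fun _ => μ) =
      ((Equiv.Perm.sign σ : ℤ) : ℂ) * ((Equiv.Perm.sign τ : ℤ) : ℂ) *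
        ∏ j, ∫ x, w j x * (g (σ j) x * g (τ j) x) ∂μ := by
    intro τ
    rw [integral_const_mul,
      integral_fintype_prod_eq_prod (fun j x => w j x * (g (σ j) x * g (τ j) x))]
  simp only [hval]
  rw [Finset.sum_eq_single σ]
  · rcases Int.units_eq_one_or (Equiv.Perm.sign σ) with h | h <;> simp [h]
  · intro τ _ hne
    -- Permutations that agree away from `l` also agree at `l`, so distinct ones differ at some
    -- index where orthogonality is available.
    obtain ⟨j, hjl, hj⟩ : ∃ j, j ≠ l ∧ σ j ≠ τ j := by
      by_contra! hc
      apply hne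
      have hrest : ∀ j, j ≠ l → (σ⁻¹ * τ) j = j := fun j hj => by
        rw [Equiv.Perm.mul_apply, Equiv.Perm.inv_eq_iff_eq, hc j hj]
      have hl : (σ⁻¹ * τ) l = l := by
        by_contra h
        exact h ((σ⁻¹ * τ).injective (hrest _ h))
      ext j
      have : (σ⁻¹ * τ) j = j := by
        by_cases hj : j = l
        · rw [hj, hl]
        · exact hrest j hj
      rw [Equiv.Perm.mul_apply, Equiv.Perm.inv_eq_iff_eq] at this
      exact this
    rw [Finset.prod_eq_zero (Finset.mem_univ j) (horth j _ _ hjl hj), mul_zero]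
  · simp

end Andreief

/-! ### The integrals of the ensemble -/

/-- The weight `x ^ a e^{-x}` with complex exponent. -/
noncomputable def laguerreWeight (a : ℂ) (x : ℝ) : ℂ := (Real.exp (-x) : ℂ) * (x : ℂ) ^ a

theorem laguerreWeight_mul_pow (a : ℂ) {x : ℝ} (hx : 0 < x) (m : ℕ) :
    laguerreWeight a x * (x : ℂ) ^ m = (Real.exp (-x) : ℂ) * (x : ℂ) ^ (a + m + 1 - 1) := by
  rw [laguerreWeight, add_sub_cancel_right, Complex.cpow_add _ _ (by exact_mod_cast hx.ne'),
    Complex.cpow_natCast, mul_assoc]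

theorem integrableOn_laguerreWeight_mul_pow {a : ℂ} (ha : -1 < a.re) (m : ℕ) :
    IntegrableOn (fun x : ℝ => laguerreWeight a x * (x : ℂ) ^ m) (Set.Ioi 0) := by
  have h0 : 0 < (a + m + 1).re := by
    have : (0 : ℝ) ≤ m := m.cast_nonneg
    simp; linarith
  exact (Complex.GammaIntegral_convergent h0).congr_fun
    (fun x hx => (laguerreWeight_mul_pow a hx m).symm) measurableSet_Ioi

theorem integral_laguerreWeight_mul_pow {a : ℂ} (ha : -1 < a.re) (m : ℕ) :
    ∫ x in Set.Ioi (0 : ℝ), laguerreWeight a x * (x : ℂ) ^ m = Complex.Gamma (a + m + 1) := by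
  have h0 : 0 < (a + m + 1).re := by
    have : (0 : ℝ) ≤ m := m.cast_nonneg
    simp; linarith
  rw [Complex.Gamma_eq_integral h0, Complex.GammaIntegral]
  exact setIntegral_congr_fun measurableSet_Ioi fun x hx => laguerreWeight_mul_pow a hx m

theorem integrableOn_laguerreWeight_mul_eval {a : ℂ} (ha : -1 < a.re) (p : ℂ[X]) :
    IntegrableOn (fun x : ℝ => laguerreWeight a x * p.eval (x : ℂ)) (Set.Ioi 0) := by
  induction p using Polynomial.induction_on' with
  | add p q hp hq =>
    simp only [eval_add, mul_add]
    exact hp.add hq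
  | monomial m c =>
    simp only [eval_monomial, mul_left_comm _ c]
    exact (integrableOn_laguerreWeight_mul_pow ha m).const_mul c

theorem integral_laguerreWeight_mul_eval {a : ℂ} (ha : -1 < a.re) (p : ℂ[X]) :
    ∫ x in Set.Ioi (0 : ℝ), laguerreWeight a x * p.eval (x : ℂ) = gammaFunctional a p := by
  induction p using Polynomial.induction_on' with
  | add p q hp hq =>
    simp only [eval_add, mul_add]
    rw [integral_add (integrableOn_laguerreWeight_mul_eval ha p)
      (integrableOn_laguerreWeight_mul_eval ha q), hp, hq, map_add]
  | monomial m c =>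
    simp only [eval_monomial, mul_left_comm _ c]
    rw [integral_const_mul, integral_laguerreWeight_mul_pow ha, ← C_mul_X_pow_eq_monomial,
      gammaFunctional_C_mul, gammaFunctional_X_pow]

/-- The boundary is null; passing to open half-lines makes all coordinates positive almost
everywhere, as the complex power laws require. -/
theorem volume_restrict_lueDomain (n : ℕ) :
    (volume : Measure (Fin n → ℝ)).restrict (lueDomain n) =
      Measure.pi fun _ => (volume : Measure ℝ).restrict (Set.Ioi 0) := by
  have h : lueDomain n = Set.univ.pi fun _ => Set.Ici (0 : ℝ) := by
    ext x; simp only [lueDomain, Set.mem_ofPred_eq, Set.mem_univ_pi, Set.mem_Ici]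
  rw [h, volume_pi, ← Measure.restrict_congr_set Measure.pi_Ioi_ae_eq_pi_Ici,
    Measure.restrict_pi_pi]

theorem ae_pos_lueDomain (n : ℕ) :
    ∀ᵐ x ∂(volume : Measure (Fin n → ℝ)).restrict (lueDomain n), ∀ j, 0 < x j := by
  rw [volume_restrict_lueDomain, ← Measure.restrict_pi_pi]
  filter_upwards [ae_restrict_mem (MeasurableSet.univ_pi fun _ => measurableSet_Ioi)] with x hx
  simpa using hx

/-- Monic polynomials of degrees 0, ..., n - 1 differ from the monomials by unitriangular row
operations, so the determinant is Vandermonde's. -/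
theorem lueDensity_eq_prod_mul_det_sq {n : ℕ} {b : ℝ} {x : Fin n → ℝ} (hx : ∀ j, 0 < x j)
    {p : Fin n → ℂ[X]} (hdeg : ∀ i, (p i).natDegree = i) (hmonic : ∀ i, (p i).Monic) :
    (lueDensity n b x : ℂ) = (∏ j, laguerreWeight b (x j)) *
      (Matrix.of fun i j => (p i).eval (x j : ℂ)).det ^ 2 := by
  have h := Matrix.det_eval_matrixOfPolynomials_eq_det_vandermonde (fun j => (x j : ℂ)) p hdeg hmonic
  rw [← Matrix.det_transpose (Matrix.of _), Matrix.det_vandermonde] at h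
  change _ = (Matrix.of fun i j => (p i).eval (x j : ℂ)).det at h
  rw [← h, lueDensity]
  push_cast
  congr 1
  · refine Finset.prod_congr rfl fun j _ => ?_
    rw [laguerreWeight, Complex.ofReal_cpow (hx j).le, mul_comm]
    push_cast
    rfl
  · rw [← Finset.prod_pow]
    refine Finset.prod_congr rfl fun i _ => ?_
    rw [← Finset.prod_pow]
    refine Finset.prod_congr rfl fun j _ => ?_
    rw [← Complex.ofReal_pow, sq_abs]
    push_cast
    rfl

theorem lueIntegrand_eq_sum {n : ℕ} {b : ℝ} {k : ℂ} {x : Fin n → ℝ} (hx : ∀ j, 0 < x j)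
    {p : Fin n → ℂ[X]} (hdeg : ∀ i, (p i).natDegree = i) (hmonic : ∀ i, (p i).Monic) :
    lueIntegrand n b k x =
      ∑ l, (∏ j, laguerreWeight (if j = l then b + k else b) (x j)) *
        (Matrix.of fun i j => (p i).eval (x j : ℂ)).det ^ 2 := by
  rw [lueIntegrand, lueDensity_eq_prod_mul_det_sq hx hdeg hmonic, Finset.sum_mul]
  refine Finset.sum_congr rfl fun l _ => ?_
  rw [← mul_assoc]
  congr 1
  rw [← Finset.mul_prod_erase _ _ (Finset.mem_univ l), ← Finset.mul_prod_erase _ _ (Finset.mem_univ l),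
    ← mul_assoc, if_pos rfl]
  congr 1
  · rw [laguerreWeight, laguerreWeight, Complex.cpow_add _ _ (by exact_mod_cast (hx l).ne')]
    ring
  · refine Finset.prod_congr rfl fun j hj => ?_
    rw [if_neg (Finset.ne_of_mem_erase hj)]

section LUE

variable {n : ℕ} {b : ℝ} {k : ℂ}

theorem integrableOn_weight_mul_monicLaguerre {a : ℂ} (ha : -1 < a.re) (i m : ℕ) :
    Integrable (fun x : ℝ => laguerreWeight a x *
      ((monicLaguerre b i).eval (x : ℂ) * (monicLaguerre b m).eval (x : ℂ)))
      (volume.restrict (Set.Ioi 0)) := by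
  simpa only [eval_mul, IntegrableOn] using
    integrableOn_laguerreWeight_mul_eval ha (monicLaguerre b i * monicLaguerre b m)

theorem integral_weight_mul_monicLaguerre {a : ℂ} (ha : -1 < a.re) (i m : ℕ) :
    ∫ x in Set.Ioi (0 : ℝ), laguerreWeight a x *
      ((monicLaguerre b i).eval (x : ℂ) * (monicLaguerre b m).eval (x : ℂ)) =
      gammaFunctional a (monicLaguerre b i * monicLaguerre b m) := by
  simpa only [eval_mul] using
    integral_laguerreWeight_mul_eval ha (monicLaguerre b i * monicLaguerre b m)

theorem integrableOn_lueIntegrand (hb : -1 < b) (hk : -1 < b + k.re) :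
    IntegrableOn (lueIntegrand n b k) (lueDomain n) := by
  have h : Integrable (fun x : Fin n → ℝ => ∑ l,
      (∏ j, laguerreWeight (if j = l then b + k else b) (x j)) *
        (Matrix.of fun i j : Fin n => (monicLaguerre b i).eval (x j : ℂ)).det ^ 2)
      (volume.restrict (lueDomain n)) := by
    rw [volume_restrict_lueDomain]
    refine integrable_finsetSum _ fun l _ =>
      integrable_prod_mul_det_sq (w := fun j => laguerreWeight (if j = l then b + k else b))
        (g := fun (i : Fin n) x => (monicLaguerre b i).eval (x : ℂ)) fun j p q => ?_
    refine integrableOn_weight_mul_monicLaguerre ?_ _ _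
    split_ifs <;> simpa
  refine h.congr ?_
  filter_upwards [ae_pos_lueDomain n] with x hx
  rw [lueIntegrand_eq_sum hx (fun i => monicLaguerre_natDegree b i)
    (fun i => monicLaguerre_monic b i)]

theorem ae_lueDensity_eq : (fun x : Fin n → ℝ => (∏ j, laguerreWeight b (x j)) *
      (Matrix.of fun i j : Fin n => (monicLaguerre b i).eval (x j : ℂ)).det ^ 2)
      =ᵐ[volume.restrict (lueDomain n)] fun x => (lueDensity n b x : ℂ) := by
  filter_upwards [ae_pos_lueDomain n] with x hx
  rw [lueDensity_eq_prod_mul_det_sq hx (fun i => monicLaguerre_natDegree b i)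
    (fun i => monicLaguerre_monic b i)]

theorem integrableOn_lueDensity (hb : -1 < b) : IntegrableOn (lueDensity n b) (lueDomain n) := by
  have h : Integrable (fun x : Fin n → ℝ => (∏ j, laguerreWeight b (x j)) *
        (Matrix.of fun i j : Fin n => (monicLaguerre b i).eval (x j : ℂ)).det ^ 2)
      (volume.restrict (lueDomain n)) := by
    rw [volume_restrict_lueDomain]
    exact integrable_prod_mul_det_sq (w := fun _ => laguerreWeight b)
      (g := fun (i : Fin n) x => (monicLaguerre b i).eval (x : ℂ)) fun j p q =>
        integrableOn_weight_mul_monicLaguerre (by simpa) _ _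
  exact (h.congr ae_lueDensity_eq).re

/-- The squared norm of the monic Laguerre polynomial. -/
noncomputable def laguerreNormSq (b : ℝ) (i : ℕ) : ℝ := i.factorial * Real.Gamma (b + i + 1)

theorem laguerreNormSq_pos (hb : -1 < b) (i : ℕ) : 0 < laguerreNormSq b i := by
  have : (0 : ℝ) ≤ i := i.cast_nonneg
  exact mul_pos (by exact_mod_cast i.factorial_pos) (Real.Gamma_pos_of_pos (by linarith))

theorem gammaFunctional_monicLaguerre_sq (hb : -1 < b) (i : ℕ) :
    gammaFunctional b (monicLaguerre b i * monicLaguerre b i) = laguerreNormSq b i := by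
  rw [gammaFunctional_monicLaguerre_mul_monicLaguerre (by simpa), if_pos rfl, laguerreNormSq]
  push_cast [← Complex.Gamma_ofReal]
  rfl

theorem lueNorm_eq (hn : 1 ≤ n) (hb : -1 < b) :
    lueNorm n b = n.factorial * ∏ i : Fin n, laguerreNormSq b i := by
  have hb' : -1 < (b : ℂ).re := by simpa
  have h : (lueNorm n b : ℂ) = (n.factorial * ∏ i : Fin n, laguerreNormSq b i : ℝ) := by
    -- All weights coincide, so any index can play the exceptional one in Andréief's identity; `hn`
    -- supplies 0.
    rw [lueNorm, ← integral_complex_ofReal, ← integral_congr_ae ae_lueDensity_eq,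
      volume_restrict_lueDomain,
      integral_prod_mul_det_sq (w := fun _ => laguerreWeight b)
        (g := fun (i : Fin n) x => (monicLaguerre b i).eval (x : ℂ)) (fun j p q =>
        integrableOn_weight_mul_monicLaguerre hb' _ _) ⟨0, hn⟩]
    · simp only [integral_weight_mul_monicLaguerre hb', gammaFunctional_monicLaguerre_sq hb]
      simp only [Equiv.prod_comp _ (fun i : Fin n => (laguerreNormSq b i : ℂ))]
      simp [Fintype.card_perm]
    · intro _ p q _ hpq
      rw [integral_weight_mul_monicLaguerre hb',
        gammaFunctional_monicLaguerre_mul_monicLaguerre hb', if_neg (Fin.val_ne_of_ne hpq)]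
  exact_mod_cast h

theorem lueNorm_pos (hn : 1 ≤ n) (hb : -1 < b) : 0 < lueNorm n b := by
  rw [lueNorm_eq hn hb]
  exact mul_pos (by exact_mod_cast n.factorial_pos)
    (Finset.prod_pos fun i _ => laguerreNormSq_pos hb i)

theorem integral_lueIntegrand (hb : -1 < b) (hk : -1 < b + k.re) :
    ∫ x in lueDomain n, lueIntegrand n b k x =
      (n.factorial * ∏ i : Fin n, (laguerreNormSq b i : ℂ)) *
      ∑ i : Fin n, gammaFunctional (b + k) (monicLaguerre b i * monicLaguerre b i) /
        laguerreNormSq b i := by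
  have hb' : -1 < (b : ℂ).re := by simpa
  have hk' : -1 < (b + k : ℂ).re := by simpa
  have hne : ∀ i : ℕ, (laguerreNormSq b i : ℂ) ≠ 0 := fun i => by
    exact_mod_cast (laguerreNormSq_pos hb i).ne'
  have hint : ∀ l j p q : Fin n, Integrable (fun x : ℝ =>
      laguerreWeight (if j = l then b + k else b) x *
      ((monicLaguerre b p).eval (x : ℂ) * (monicLaguerre b q).eval (x : ℂ)))
      (volume.restrict (Set.Ioi 0)) := fun l j p q => by
    refine integrableOn_weight_mul_monicLaguerre ?_ _ _
    split_ifs <;> assumption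
  have hcongr : (fun x => lueIntegrand n b k x) =ᵐ[volume.restrict (lueDomain n)]
      fun x : Fin n → ℝ => ∑ l,
      (∏ j, laguerreWeight (if j = l then b + k else b) (x j)) *
        (Matrix.of fun i j : Fin n => (monicLaguerre b i).eval (x j : ℂ)).det ^ 2 := by
    filter_upwards [ae_pos_lueDomain n] with x hx
    rw [lueIntegrand_eq_sum hx (fun i => monicLaguerre_natDegree b i)
      (fun i => monicLaguerre_monic b i)]
  rw [integral_congr_ae hcongr, volume_restrict_lueDomain, integral_finsetSum _ fun l _ =>
    integrable_prod_mul_det_sq (w := fun j => laguerreWeight (if j = l then b + k else b))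
      (g := fun (i : Fin n) x => (monicLaguerre b i).eval (x : ℂ)) (hint l)]
  have hterm : ∀ l : Fin n, ∫ x : Fin n → ℝ,
      (∏ j, laguerreWeight (if j = l then b + k else b) (x j)) *
        (Matrix.of fun i j : Fin n => (monicLaguerre b i).eval (x j : ℂ)).det ^ 2
        ∂(Measure.pi fun _ => volume.restrict (Set.Ioi 0)) =
      ∑ σ : Equiv.Perm (Fin n), (∏ i : Fin n, (laguerreNormSq b i : ℂ)) *
        (gammaFunctional (b + k) (monicLaguerre b (σ l) * monicLaguerre b (σ l)) /
          laguerreNormSq b (σ l)) := by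
    intro l
    rw [integral_prod_mul_det_sq (w := fun j => laguerreWeight (if j = l then b + k else b))
      (g := fun (i : Fin n) x => (monicLaguerre b i).eval (x : ℂ)) (hint l) l]
    · refine Finset.sum_congr rfl fun σ _ => ?_
      rw [← Equiv.prod_comp σ (fun i : Fin n => (laguerreNormSq b i : ℂ)),
        ← Finset.mul_prod_erase _ _ (Finset.mem_univ l),
        ← Finset.mul_prod_erase Finset.univ (fun i => (laguerreNormSq b (σ i) : ℂ))
          (Finset.mem_univ l), if_pos rfl, integral_weight_mul_monicLaguerre hk']
      have : ∏ j ∈ Finset.univ.erase l, ∫ x in Set.Ioi (0 : ℝ),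
          laguerreWeight (if j = l then b + k else b) x *
          ((monicLaguerre b (σ j)).eval (x : ℂ) * (monicLaguerre b (σ j)).eval (x : ℂ)) =
          ∏ j ∈ Finset.univ.erase l, (laguerreNormSq b (σ j) : ℂ) :=
        Finset.prod_congr rfl fun j hj => by
          rw [if_neg (Finset.ne_of_mem_erase hj), integral_weight_mul_monicLaguerre hb',
            gammaFunctional_monicLaguerre_sq hb]
      rw [this]
      have := hne (σ l)
      field_simp
    · intro j p q hj hpq
      rw [if_neg hj, integral_weight_mul_monicLaguerre hb',
        gammaFunctional_monicLaguerre_mul_monicLaguerre hb', if_neg (Fin.val_ne_of_ne hpq)]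
  simp only [hterm, ← Finset.mul_sum]
  -- For fixed σ, the index σ l runs over all of `Fin n` as l does, so every σ gives the same sum
  -- and the count of permutations yields n!.
  rw [Finset.sum_comm]
  simp only [Equiv.sum_comp _ (fun i : Fin n =>
    gammaFunctional (b + k) (monicLaguerre b i * monicLaguerre b i) / (laguerreNormSq b i : ℂ))]
  simp [Fintype.card_perm]
  ring

theorem lueAverage_eq_lueMoment (hn : 1 ≤ n) (hb : -1 < b) (hk : -1 < b + k.re) :
    lueAverage n b k = lueMoment n b k := by
  have hb' : -1 < (b : ℂ).re := by simpa
  have hk' : -1 < (b + k : ℂ).re := by simpa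
  have hC : (lueNorm n b : ℂ) ≠ 0 := by exact_mod_cast (lueNorm_pos hn hb).ne'
  have hC' : (n.factorial * ∏ i : Fin n, (laguerreNormSq b i : ℂ)) = lueNorm n b := by
    rw [lueNorm_eq hn hb]; push_cast; rfl
  rw [lueAverage, integral_lueIntegrand hb hk, hC', ← mul_assoc, one_div, inv_mul_cancel₀ hC,
    one_mul, ← sum_ringChoose_sq_eq_lueMoment hb' hk',
    Fin.sum_univ_eq_sum_range (fun i => gammaFunctional (b + k)
      (monicLaguerre b i * monicLaguerre b i) / (laguerreNormSq b i : ℂ))]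
  refine Finset.sum_congr rfl fun i _ => ?_
  rw [gammaFunctional_add_monicLaguerre_sq hk', laguerreNormSq, Finset.sum_div, Finset.mul_sum]
  refine Finset.sum_congr rfl fun m _ => ?_
  have hi : (i.factorial : ℂ) ≠ 0 := by exact_mod_cast i.factorial_ne_zero
  push_cast [← Complex.Gamma_ofReal]
  field_simp

end LUE

/-! ### Generalized binomials and the summands -/

theorem isNegInt_iff {z : ℂ} : IsNegInt z ↔ ∃ m : ℕ, z + 1 = -m := by
  refine exists_congr fun m => ?_
  constructor <;> intro h <;> linear_combination h

theorem genBinom_neg_one (k : ℂ) : genBinom k (-1) = 0 := by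
  simp [genBinom]

theorem genBinom_zero (k : ℂ) : genBinom k 0 = 1 := by
  unfold genBinom
  split_ifs with h
  · obtain ⟨m, rfl⟩ := h
    have : Complex.Gamma ((m : ℂ) + 1) ≠ 0 := by
      rw [Complex.Gamma_nat_eq_factorial]
      exact_mod_cast m.factorial_ne_zero
    simp only [neg_neg, Int.cast_zero, add_zero, zero_add, Complex.Gamma_one, zpow_zero, mul_one,
      one_mul]
    exact div_self this
  · have : Complex.Gamma (k + 1) ≠ 0 := by
      rw [Ne, Complex.Gamma_eq_zero_iff, ← isNegInt_iff]
      exact h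
    simp [this]

theorem genBinom_succ (k : ℂ) (j : ℕ) :
    ((j : ℂ) + 1) * genBinom k ((j : ℤ) + 1) = (k - j) * genBinom k j := by
  have hj : (j : ℂ) + 1 ≠ 0 := Nat.cast_add_one_ne_zero j
  have hG : Complex.Gamma ((j : ℂ) + 1) ≠ 0 := by
    rw [Complex.Gamma_nat_eq_factorial]
    exact_mod_cast j.factorial_ne_zero
  unfold genBinom
  split_ifs with h
  · obtain ⟨m, rfl⟩ := h
    have hm : Complex.Gamma ((m : ℂ) + 1) ≠ 0 := by
      rw [Complex.Gamma_nat_eq_factorial]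
      exact_mod_cast m.factorial_ne_zero
    have hmj : (m : ℂ) + 1 + j ≠ 0 := by
      rw [add_right_comm]; exact_mod_cast Nat.succ_ne_zero (m + j)
    push_cast
    rw [neg_neg, Complex.Gamma_add_one _ hj, ← add_assoc ((m : ℂ) + 1),
      Complex.Gamma_add_one _ hmj, zpow_add₀ (by norm_num)]
    field_simp
    ring
  · push_cast
    rw [Complex.Gamma_add_one _ hj, show k - (j + 1 : ℂ) + 1 = k - j by ring]
    -- At the poles of Γ(k - j) both sides vanish, by the value 0 that `Complex.Gamma` takes there.
    rcases eq_or_ne (k - j) 0 with h0 | h0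
    · simp [h0]
    · rw [Complex.Gamma_add_one _ h0]
      rcases eq_or_ne (Complex.Gamma (k - j)) 0 with h1 | h1
      · simp [h1]
      · field_simp

/-- Both sides are 1 at j = 0 and obey the same first-order recurrence. This covers the two branches
of `genBinom` at once and gives a polynomial in k. -/
theorem genBinom_natCast (k : ℂ) (j : ℕ) : genBinom k j = Ring.choose k j := by
  induction j with
  | zero => simpa using genBinom_zero k
  | succ j ih =>
    have hj : (j : ℂ) + 1 ≠ 0 := Nat.cast_add_one_ne_zero j
    apply mul_left_cancel₀ hj
    rw [succ_mul_ringChoose_succ, ← ih, ← genBinom_succ]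
    push_cast
    rfl

theorem lueTerm_zero (n : ℕ) (b k : ℂ) : lueTerm n b k 0 = 0 := by
  simp [lueTerm, genBinom_neg_one]

theorem lueTerm_succ {n r : ℕ} (b k : ℂ) (hr : r < n) :
    lueTerm n b k (r + 1) = k * (lueCoeff k r * ((n.factorial : ℂ) / (n - 1 - r).factorial) *
      (Complex.Gamma (b + k + n - r) * (Complex.Gamma (b + n))⁻¹)) := by
  have e1 : (((r + 1 : ℕ) : ℤ) - 1) = (r : ℕ) := by push_cast; ring
  have e2 : (n : ℂ) + 1 + -((r + 1 : ℕ) : ℂ) = ((n - 1 - r : ℕ) : ℂ) + 1 := by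
    rw [Nat.sub_sub, Nat.cast_sub (by omega)]; push_cast; ring
  rw [lueTerm, e1, genBinom_natCast, genBinom_natCast, pochhammerSymbol, pochhammerSymbol, e2,
    Complex.Gamma_nat_eq_factorial, Complex.Gamma_nat_eq_factorial, ← mul_assoc, ← mul_assoc,
    ← mul_lueCoeff,
    show b + n + (k - ((r + 1 : ℕ) : ℂ) + 1) = b + k + n - r by push_cast; ring]
  have h1 : ((n - 1 - r).factorial : ℂ) ≠ 0 := by exact_mod_cast Nat.factorial_ne_zero _
  have h2 : (n.factorial : ℂ) ≠ 0 := by exact_mod_cast Nat.factorial_ne_zero _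
  rw [← div_eq_mul_inv]
  field_simp

theorem lueMoment_eq_sum_lueTerm (n : ℕ) (b : ℂ) {k : ℂ} (hk : k ≠ 0) :
    lueMoment n b k = 1 / k * ∑ j ∈ Finset.range (n + 1), lueTerm n b k j := by
  rw [Finset.sum_range_succ', lueTerm_zero, add_zero, lueMoment,
    Finset.sum_congr rfl fun r hr => lueTerm_succ b k (Finset.mem_range.1 hr), ← Finset.mul_sum,
    ← mul_assoc, one_div, inv_mul_cancel₀ hk, one_mul]

theorem lueTerm_natCast_eq_zero {n k j : ℕ} (b : ℂ) (h : k < j) : lueTerm n b k j = 0 := by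
  rw [lueTerm, genBinom_natCast, Ring.choose_natCast, Nat.choose_eq_zero_of_lt h]
  simp

/-! ### Analytic continuation and its uniqueness -/

theorem analyticAt_Gamma {z : ℂ} (hz : ∀ m : ℕ, z ≠ -m) : AnalyticAt ℂ Complex.Gamma z := by
  rw [Complex.analyticAt_iff_eventually_differentiableAt]
  have h : (Complex.Gamma z)⁻¹ ≠ 0 := inv_ne_zero (Complex.Gamma_ne_zero hz)
  -- The entire function 1 / Γ stays nonzero near z, whereas it is 0 at every pole of Γ; hence no
  -- pole is close to z.
  filter_upwards [Complex.differentiable_one_div_Gamma.continuous.continuousAt.eventually_ne h]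
    with w hw
  refine Complex.differentiableAt_Gamma w fun m hm => hw ?_
  rw [hm, Complex.Gamma_neg_nat_eq_zero, inv_zero]

theorem analyticAt_ringChoose (j : ℕ) (z : ℂ) : AnalyticAt ℂ (fun k => Ring.choose k j) z := by
  induction j with
  | zero => simpa using analyticAt_const
  | succ j ih =>
    have hj : (j : ℂ) + 1 ≠ 0 := Nat.cast_add_one_ne_zero j
    have : (fun k : ℂ => Ring.choose k (j + 1)) =
        fun k => (k - j) * Ring.choose k j / ((j : ℂ) + 1) := by
      funext k
      rw [eq_div_iff hj, mul_comm, succ_mul_ringChoose_succ]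
    rw [this]
    exact ((analyticAt_id.sub analyticAt_const).mul ih).div analyticAt_const hj

theorem analyticAt_lueCoeff (r : ℕ) (z : ℂ) : AnalyticAt ℂ (fun k => lueCoeff k r) z := by
  have h : AnalyticAt ℂ (fun k : ℂ => Ring.choose (k - 1) r) z :=
    AnalyticAt.fun_comp (g := fun k => Ring.choose k r) (f := fun k => k - 1)
      (analyticAt_ringChoose r (z - 1)) (analyticAt_id.sub analyticAt_const)
  exact (h.mul (analyticAt_ringChoose r z)).div analyticAt_const (Nat.cast_add_one_ne_zero r)

theorem analyticOnNhd_lueMoment (n : ℕ) :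
    AnalyticOnNhd ℂ (fun p : ℂ × ℂ => lueMoment n p.1 p.2) (lueParams n) := by
  rintro ⟨b, k⟩ ⟨-, hk⟩
  refine Finset.analyticAt_fun_sum _ fun r hr => ?_
  have hr' : r < n := Finset.mem_range.1 hr
  have h1 : AnalyticAt ℂ (fun p : ℂ × ℂ => lueCoeff p.2 r) (b, k) :=
    AnalyticAt.fun_comp (g := fun k => lueCoeff k r) (f := Prod.snd) (analyticAt_lueCoeff r k) analyticAt_snd
  have h2 : AnalyticAt ℂ (fun p : ℂ × ℂ => Complex.Gamma (p.1 + p.2 + n - r)) (b, k) := by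
    refine AnalyticAt.fun_comp (g := Complex.Gamma) (analyticAt_Gamma fun m hm => hk ?_)
      -- Since n - r = d + 1 ≥ 1, a pole at -m would force b + k = -(m + d + 1).
      (((analyticAt_fst.add analyticAt_snd).add analyticAt_const).sub analyticAt_const)
    obtain ⟨d, rfl⟩ := Nat.exists_eq_add_of_lt hr'
    refine ⟨m + d, ?_⟩
    push_cast at hm ⊢
    linear_combination hm
  have h3 : AnalyticAt ℂ (fun p : ℂ × ℂ => (Complex.Gamma (p.1 + n))⁻¹) (b, k) :=
    AnalyticAt.fun_comp (g := fun z => (Complex.Gamma z)⁻¹) (f := fun p : ℂ × ℂ => p.1 + n)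
      (Complex.differentiable_one_div_Gamma.analyticAt (b + n))
      (analyticAt_fst.add analyticAt_const)
  exact (h1.mul analyticAt_const).mul (h2.mul h3)

theorem isLUEMoment_lueMoment {n : ℕ} (hn : 1 ≤ n) : IsLUEMoment n (lueMoment n) where
  analytic := analyticOnNhd_lueMoment n
  eq_average _ _ hb hk := (lueAverage_eq_lueMoment hn hb hk).symm

theorem countable_setOf_isNegInt_add (c : ℂ) : {b : ℂ | IsNegInt (b + c)}.Countable := by
  refine (Set.countable_range fun m : ℕ => -((m : ℂ) + 1) - c).mono ?_
  rintro b ⟨m, hm⟩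
  exact ⟨m, by simp [← hm]⟩

/-- The slice is the complement of a countable set in a real vector space of dimension 2. -/
theorem isPreconnected_lueParams_slice (n : ℕ) (k : ℂ) :
    IsPreconnected {b : ℂ | (b, k) ∈ lueParams n} := by
  have h := ((countable_setOf_isNegInt_add n).union
    (countable_setOf_isNegInt_add k)).isConnected_compl_of_one_lt_rank
      (by rw [Complex.rank_real_complex]; norm_num)
  convert h.isPreconnected using 1
  ext b
  simp [lueParams]

theorem not_isNegInt_of_re {z : ℂ} (hz : -1 < z.re) : ¬ IsNegInt z := by
  rintro ⟨m, rfl⟩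
  have : (0 : ℝ) ≤ m := m.cast_nonneg
  simp at hz
  linarith

/-- For fixed k, every slice in b contains a real ray on which both functions equal the average. The
ray accumulates inside the connected slice, so the identity theorem in one variable suffices. -/
theorem IsLUEMoment.eq {n : ℕ} {M M' : ℂ → ℂ → ℂ} (hM : IsLUEMoment n M) (hM' : IsLUEMoment n M') :
    ∀ p ∈ lueParams n, M p.1 p.2 = M' p.1 p.2 := by
  rintro ⟨b, k⟩ hp
  have hslice : ∀ {N : ℂ → ℂ → ℂ}, IsLUEMoment n N →
      AnalyticOnNhd ℂ (fun b => N b k) {b : ℂ | (b, k) ∈ lueParams n} := fun {N} hN b hb =>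
    AnalyticAt.fun_comp (g := fun p : ℂ × ℂ => N p.1 p.2) (f := fun b : ℂ => (b, k))
      (hN.analytic _ hb) (analyticAt_id.prod analyticAt_const)
  -- With this c, every real b ≥ c satisfies both b > -1 and b + Re k > -1.
  set c : ℝ := max 0 (-k.re) with hc
  have hc0 : 0 ≤ c := le_max_left _ _
  have hck : -k.re ≤ c := le_max_right _ _
  have hmem : ∀ x : ℝ, c ≤ x → ((x : ℂ), k) ∈ lueParams n := by
    intro x hx
    have : (0 : ℝ) ≤ n := n.cast_nonneg
    exact ⟨not_isNegInt_of_re (by simp; linarith), not_isNegInt_of_re (by simp; linarith)⟩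
  refine (hslice hM).eqOn_of_preconnected_of_frequently_eq (hslice hM')
    (isPreconnected_lueParams_slice n k) (hmem c le_rfl) ?_ hp
  have htend : Filter.Tendsto (fun x : ℝ => (x : ℂ)) (nhdsWithin c (Set.Ioi c))
      (nhdsWithin (c : ℂ) {(c : ℂ)}ᶜ) := by
    refine tendsto_nhdsWithin_of_tendsto_nhds_of_eventually_within _
      (Complex.continuous_ofReal.continuousAt.tendsto.mono_left nhdsWithin_le_nhds) ?_
    filter_upwards [self_mem_nhdsWithin] with x hx
    simpa using (ne_of_gt hx)
  refine htend.frequently (Filter.Eventually.frequently ?_)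
  filter_upwards [self_mem_nhdsWithin] with x hx
  have hx' : c < x := hx
  rw [hM.eq_average x k (by linarith) (by linarith),
    hM'.eq_average x k (by linarith) (by linarith)]

/-! ### Integer orders and conclusion -/

theorem ringChoose_neg_natCast {k : ℕ} (hk : 1 ≤ k) (j : ℕ) :
    Ring.choose (-(k : ℂ)) j = (-1) ^ j * (Nat.choose (k + j - 1) (k - 1) : ℂ) := by
  induction j with
  | zero => simp
  | succ j ih =>
    have hj : (j : ℂ) + 1 ≠ 0 := Nat.cast_add_one_ne_zero j
    apply mul_left_cancel₀ hj
    rw [succ_mul_ringChoose_succ, ih]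
    obtain ⟨d, rfl⟩ := Nat.exists_eq_add_of_le' hk
    have h : ((d + j + 1).choose d : ℂ) * (j + 1) = (d + j).choose d * (d + j + 1) := by
      have := Nat.add_one_mul_choose_eq (d + j) j
      rw [Nat.choose_symm_add (a := d) (b := j) |>.symm] at this
      have h2 := Nat.choose_symm_add (a := d) (b := j + 1)
      rw [← add_assoc] at h2
      rw [← h2] at this
      exact_mod_cast by rw [← this]; ring
    rw [show d + 1 + j - 1 = d + j by omega, show d + 1 + (j + 1) - 1 = d + j + 1 by omega,
      Nat.add_sub_cancel, pow_succ]
    push_cast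
    linear_combination (-1) ^ j * h

/-- The two binomials contribute signs (-1)^(j+1) and (-1)^j, whose product -1 cancels the sign of 1
/ (-k). The shift from j to j + 1 absorbs the vanishing term of index 0. -/
theorem lueMoment_neg_natCast (n : ℕ) (b : ℂ) {k : ℕ} (hk : 1 ≤ k) :
    lueMoment n b (-(k : ℂ)) = 1 / (k : ℂ) * ∑ j ∈ Finset.range n,
      (Nat.choose (k + j) (k - 1) : ℂ) * (Nat.choose (k + j - 1) (k - 1) : ℂ) *
        (pochhammerSymbol (b + n) (-(k : ℂ) - j) /
          pochhammerSymbol ((n : ℂ) + 1) (-(j : ℂ) - 1)) := by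
  have hk0 : (k : ℂ) ≠ 0 := by exact_mod_cast (by omega : k ≠ 0)
  rw [lueMoment_eq_sum_lueTerm n b (neg_ne_zero.2 hk0), Finset.sum_range_succ', lueTerm_zero,
    add_zero, Finset.mul_sum, Finset.mul_sum]
  refine Finset.sum_congr rfl fun j _ => ?_
  have e1 : (((j + 1 : ℕ) : ℤ) - 1) = (j : ℕ) := by push_cast; ring
  have hs : ((-1 : ℂ) ^ j) * (-1) ^ j = 1 := by rw [← mul_pow]; simp
  rw [lueTerm, e1, genBinom_natCast, genBinom_natCast, ringChoose_neg_natCast hk,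
    ringChoose_neg_natCast hk, show k + (j + 1) - 1 = k + j by omega,
    show -(k : ℂ) - ((j + 1 : ℕ) : ℂ) + 1 = -(k : ℂ) - j by push_cast; ring,
    show -((j + 1 : ℕ) : ℂ) = -(j : ℂ) - 1 by push_cast; ring, pow_succ, one_div, one_div,
    inv_neg]
  linear_combination ((k : ℂ)⁻¹ * (Nat.choose (k + j) (k - 1) : ℂ) *
    (Nat.choose (k + j - 1) (k - 1) : ℂ) * (pochhammerSymbol (b + n) (-(k : ℂ) - j) /
      pochhammerSymbol ((n : ℂ) + 1) (-(j : ℂ) - 1))) * hs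

theorem sum_lueTerm_natCast (n : ℕ) (b : ℂ) (k : ℕ) :
    ∑ j ∈ Finset.range (n + 1), lueTerm n b k j =
      ∑ j ∈ Finset.range (min n k + 1), lueTerm n b k j := by
  symm
  refine Finset.sum_subset (Finset.range_mono (by omega)) fun j hj hj' => ?_
  simp only [Finset.mem_range] at hj hj'
  exact lueTerm_natCast_eq_zero b (by omega)

theorem ncard_lueTerm_ne_zero_le (n : ℕ) (b : ℂ) (k : ℕ) :
    {j : ℕ | j ≤ n ∧ lueTerm n b k j ≠ 0}.ncard ≤ k := by
  have h : {j : ℕ | j ≤ n ∧ lueTerm n b k j ≠ 0} ⊆ (Finset.Icc 1 k : Finset ℕ) := by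
    rintro j ⟨-, hj⟩
    rw [Finset.mem_coe, Finset.mem_Icc]
    constructor
    · by_contra hj0
      rw [show j = 0 by omega, lueTerm_zero] at hj
      exact hj rfl
    · by_contra hjk
      exact hj (lueTerm_natCast_eq_zero b (by omega))
  simpa [Set.ncard_coe_finset] using Set.ncard_le_ncard h (Finset.finite_toSet _)

theorem mainTheorem2 (n : ℕ) (hn : 1 ≤ n) :
    -- the ensemble is well defined, and its moments are absolutely convergent integrals
    (∀ b : ℝ, -1 < b →
      IntegrableOn (lueDensity n b) (lueDomain n) ∧ 0 < lueNorm n b ∧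
      ∀ k : ℂ, -1 < b + k.re → IntegrableOn (lueIntegrand n b k) (lueDomain n)) ∧
    -- the formula for the average itself
    (∀ (b : ℝ) (k : ℂ), -1 < b → -1 < b + k.re → k ≠ 0 →
      lueAverage n b k = 1 / k * ∑ j ∈ Finset.range (n + 1), lueTerm n b k j) ∧
    -- the moments for all admissible parameters
    ∃ M : ℂ → ℂ → ℂ, IsLUEMoment n M ∧
      (∀ M' : ℂ → ℂ → ℂ, IsLUEMoment n M' → ∀ p ∈ lueParams n, M' p.1 p.2 = M p.1 p.2) ∧
      (∀ b k : ℂ, ¬ IsNegInt (b + n) → ¬ IsNegInt (b + k) → k ≠ 0 →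
        M b k = 1 / k * ∑ j ∈ Finset.range (n + 1), lueTerm n b k j) ∧
      -- positive integer order
      (∀ (b : ℂ) (k : ℕ), 1 ≤ k → ¬ IsNegInt (b + n) → ¬ IsNegInt (b + k) →
        M b k = 1 / (k : ℂ) * ∑ j ∈ Finset.range (min n k + 1), lueTerm n b k j ∧
        {j : ℕ | j ≤ n ∧ lueTerm n b k j ≠ 0}.ncard ≤ k) ∧
      -- negative integer order
      (∀ (b : ℂ) (k : ℕ), 1 ≤ k → ¬ IsNegInt (b + n) → ¬ IsNegInt (b - k) →
        M b (-(k : ℂ)) = 1 / (k : ℂ) * ∑ j ∈ Finset.range n,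
          (Nat.choose (k + j) (k - 1) : ℂ) * (Nat.choose (k + j - 1) (k - 1) : ℂ) *
            (pochhammerSymbol (b + n) (-(k : ℂ) - j) /
              pochhammerSymbol ((n : ℂ) + 1) (-(j : ℂ) - 1))) := by
  refine ⟨fun b hb => ⟨integrableOn_lueDensity hb, lueNorm_pos hn hb, fun k hk =>
      integrableOn_lueIntegrand hb hk⟩, fun b k hb hk hk0 => ?_, lueMoment n,
    isLUEMoment_lueMoment hn, fun M' hM' => hM'.eq (isLUEMoment_lueMoment hn),
    fun b k _ _ hk0 => lueMoment_eq_sum_lueTerm n b hk0, fun b k hk _ _ => ⟨?_,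
      ncard_lueTerm_ne_zero_le n b k⟩, fun b k hk _ _ => lueMoment_neg_natCast n b hk⟩
  · rw [lueAverage_eq_lueMoment hn hb hk, lueMoment_eq_sum_lueTerm n b hk0]
  · rw [← sum_lueTerm_natCast, lueMoment_eq_sum_lueTerm]
    exact_mod_cast (by omega : k ≠ 0)
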